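/- **Setting.** Let $n,m,q_A,q_B,q_{Ad},q_{Bd},\eta,\kappa$ be nonnegative integers. Consider the nominal system with $\eta$ internal and $\kappa$ external point delays $$\dot x(t)=A(z^{A})x(t)+B(z^{B})u(t)+\sum_{j=1}^{\eta}A_j(z^{Ad})\,x(t-h_j)+\sum_{j=1}^{\kappa}B_j(z^{Bd})\,u(t-h'_j),$$ with state in $\mathbb C^n$, input in $\mathbb C^m$, and $$A(z^A)=A_0^{0}+\sum_{i=1}^{q_A}z^A_iA_i^{0},\quad B(z^B)=B_0^{0}+\sum_{i=1}^{q_B}z^B_iB_i^{0},\quad A_j(z^{Ad})=\sum_{i=1}^{q_{Ad}}z^{Ad}_iA_{ji},\quad B_j(z^{Bd})=\sum_{i=1}^{q_{Bd}}z^{Bd}_iB_{ji}$$ for constant complex matrices. Let $C=C^{A}\times C^{B}\times C^{Ad}\times C^{Bd}\subset\mathbb C^{q_A}\times\mathbb C^{q_B}\times\mathbb C^{q_{Ad}}\times\mathbb C^{q_{Bd}}$ be bounded, $z=(z^A,z^B,z^{Ad},z^{Bd})$. For $s\in\mathbb C$, $w\in\mathbb C^\eta$, $w'\in\mathbb C^\kappa$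 let $$Z(s,w,w',z)=\Bigl(sI_n-A(z^A)-\sum_j w_jA_j(z^{Ad})\ :\ B(z^B)+\sum_j w'_jB_j(z^{Bd})\Bigr),\qquad \hat Z=ZZ^*.$$ The system is *controllable on $C$ for the delays $h,h'$* (spectral controllability) if $\operatorname{rank}Z(s,(e^{-h_js})_j,(e^{-h'_js})_j,z)=n$ for all $s\in\mathbb C$, $z\in C$. It is *controllable on $C$ independent of the delays* if this holds for all $\eta$ pairwise distinct nonnegative $h_j$ and all $\kappa$ pairwise distinct nonnegative $h'_j$. Extended variables are tuples $\hat\sigma=(\sigma,\rho,\rho',\omega,\varphi,\varphi')$ with $\sigma,\omega\in\mathbb R$, $\rho_j,\rho'_j>0$, $\varphi_j,\varphi'_j\in[0,2\pi)$; put $s=\sigma+i\omega$ and $\hat Z(\hat\sigma,z)=\hat Z\bigl(s,(\rho_je^{i\varphi_j})_j,(\rho'_je^{i\varphi'_j})_j,z\bigr)$. Let $\Gamma_{\rm free}$ be the set of all of them. Let $\Gamma(h,h')$ be the set of those with $\rho_j=e^{-h_j\sigma}$, $\varphi_j\equiv-h_j\omega$, $\rho'_j=e^{-h'_j\sigma}$,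 $\varphi'_j\equiv-h'_j\omega\pmod{2\pi}$ for all $j$. Let $\Gamma_{\rm some}$ be the union of the $\Gamma(h,h')$ over all pairwise distinct nonnegative $h_j$ and pairwise distinct nonnegative $h'_j$. Denote by $\Gamma^R$ the part of a set $\Gamma$ with $|s|\le R$ and all $\rho_j,\rho'_j\le R$. **Finite cover test.** Let $f:\mathbb R^d\to\mathbb R$, $T\subset\mathbb R^d$ and $\delta>0$. *The test for $f$ on $T$ passes at level $\delta$* if $T$ is covered by finitely many open hyper-rectangles $H_i$, with sample points $p_i\in H_i\cap T$ and numbers $\varepsilon_i>0$, $M_i\ge0$, $\delta_i\ge\delta$, such that the edges of $H_i$ have length at most $\varepsilon_i$, all partial derivatives satisfy $|\partial_jf|\le M_i$ on $H_i$, $dM_i\varepsilon_i\le\delta_i$, and $f(p_i)-dM_i\varepsilon_i\ge\delta_i$. Complex variables are described by their real and imaginary parts. **Theorem.** (i) Let $\Gamma$ be $\Gamma_{\rm free}$ or $\Gamma_{\rm some}$. If there is $\delta>0$ with $\det\hat Z(\hat\sigma,z)\ge\delta$ for all $\hat\sigma\in\Gamma$, $z\in C$, then the system is controllable on $C$ independent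 of the delays. (ii) Let $h_1,\dots,h_\eta$ be positive and pairwise distinct, and $h'_1,\dots,h'_\kappa$ be positive and pairwise distinct. If there is $\delta>0$ with $\det\hat Z(\hat\sigma,z)\ge\delta$ for all $\hat\sigma\in\Gamma(h,h')$, $z\in C$, then the system is controllable on $C$ for the delays $h,h'$. (iii) These conditions can be tested by finitely many computations on finite covers: - For $\Gamma$ as in (i) and every $R>0$, the test for $\det\hat Z$ as a function of $(\hat\sigma,z)$ on $\Gamma^R\times C$ passes at some level $\delta>0$ if and only if $\det\hat Z$ has a positive lower bound on $\Gamma^R\times C$. There is $R_0>0$ such that, if the test passes at some level $\delta>0$ for one $R\ge R_0$, then the system is controllable on $C$ independent of the delays. - For $h,h'$ as in (ii) and every $R>0$, the test for $(s,z)\mapsto\det\hat Z(s,(e^{-h_js})_j,(e^{-h'_js})_j,z)$ on $\{|s|\le R\}\times C$ passes at some level $\delta>0$ if and only if $\det\hat Z$ has a positive lower bound on $\{\hat\sigma\in\Gamma(h,h'):|s|\le R\}\times C$. There is $R_0>0$ such that, if the test passes at some level $\delta>0$ for one $R\ge R_0$, then the system is controllable on $C$ for the delays $h,h'$. - For every $r$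 there is $R_0$ such that $\operatorname{rank}Z(s,w,w',z)=n$ whenever $|s|>R_0$, all $|w_j|\le r$, and $z\in C$ (with $w'$ arbitrary). -/

import Mathlib

open scoped Matrix

namespace DelayControl

/-- The nominal linear system with `η` internal (state) and `κ` external (input) point delays
`x'(t) = A(zA) x(t) + B(zB) u(t) + ∑ j, Aⱼ(zAd) x(t - hⱼ) + ∑ j, Bⱼ(zBd) u(t - h'ⱼ)`,
given by its constant coefficient matrices. The output equation plays no part in
controllability and is left out. The delays are not part of this data. -/
structure NominalSystem (n m qA qB qAd qBd η κ : ℕ) where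
  /-- coefficients of the dynamics matrix; index `0` is the constant term -/
  A : Fin (qA + 1) → Matrix (Fin n) (Fin n) ℂ
  /-- coefficients of the control matrix; index `0` is the constant term -/
  B : Fin (qB + 1) → Matrix (Fin n) (Fin m) ℂ
  /-- coefficients of the matrices multiplying the delayed states -/
  Ad : Fin η → Fin qAd → Matrix (Fin n) (Fin n) ℂ
  /-- coefficients of the matrices multiplying the delayed inputs -/
  Bd : Fin κ → Fin qBd → Matrix (Fin n) (Fin m) ℂ

/-- Parameter tuples `(zA, zB, zAd, zBd)`. The fixed leading entry `1` of `zA` and `zB` is not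
stored; it is put back by `Fin.cons 1` below. -/
abbrev Param (qA qB qAd qBd : ℕ) : Type :=
  (Fin qA → ℂ) × (Fin qB → ℂ) × (Fin qAd → ℂ) × (Fin qBd → ℂ)

/-- The tuple `(σ, ρ, ρ', ω, φ, φ')` of extended variables: `s = σ + i ω`, and `ρⱼ`, `φⱼ`
(resp. `ρ'ⱼ`, `φ'ⱼ`) are the modulus and the argument of the complex number that stands for
`exp (-hⱼ s)` (resp. for `exp (-h'ⱼ s)`). -/
structure SigmaHat (η κ : ℕ) where
  σ : ℝ
  ω : ℝ
  ρ : Fin η → ℝ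
  φ : Fin η → ℝ
  ρ' : Fin κ → ℝ
  φ' : Fin κ → ℝ

section Variables

variable {η κ : ℕ}

/-- The Laplace argument `s = σ + i ω`. -/
def SigmaHat.s (v : SigmaHat η κ) : ℂ := (v.σ : ℂ) + (v.ω : ℂ) * Complex.I

/-- The point of modulus `r` (for `0 ≤ r`) and argument `θ` of the complex plane. -/
noncomputable def polar (r θ : ℝ) : ℂ :=
  (r : ℂ) * ((Real.cos θ : ℂ) + (Real.sin θ : ℂ) * Complex.I)

/-- All values of the extended variables with no reference to delays: `s` is any complex number,
the moduli are positive and the angles lie in `[0, 2π)`. -/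
def delayFree (η κ : ℕ) : Set (SigmaHat η κ) :=
  {v | (∀ j, 0 < v.ρ j) ∧ (∀ j, v.φ j ∈ Set.Ico 0 (2 * Real.pi)) ∧
    (∀ j, 0 < v.ρ' j) ∧ (∀ j, v.φ' j ∈ Set.Ico 0 (2 * Real.pi))}

/-- The extended variables that satisfy the constraints given by the delays `h`, `h'`:
`ρⱼ = exp (-hⱼ σ)` (that is `σ = -ln ρⱼ / hⱼ` when `hⱼ ≠ 0`) and `φⱼ = -hⱼ ω` modulo `2π`,
and likewise for the external delays. So `polar ρⱼ φⱼ = exp (-hⱼ s)`. -/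
def linkedTo (h : Fin η → ℝ) (h' : Fin κ → ℝ) : Set (SigmaHat η κ) :=
  {v | v ∈ delayFree η κ ∧
    (∀ j, v.ρ j = Real.exp (-(h j * v.σ))) ∧
    (∀ j, ∃ k : ℤ, v.φ j = -(h j * v.ω) + 2 * Real.pi * k) ∧
    (∀ j, v.ρ' j = Real.exp (-(h' j * v.σ))) ∧
    (∀ j, ∃ k : ℤ, v.φ' j = -(h' j * v.ω) + 2 * Real.pi * k)}

/-- The extended variables that satisfy the constraints for some `η` distinct nonnegative internal
delays and some `κ` distinct nonnegative external delays. -/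
def linkedToSome (η κ : ℕ) : Set (SigmaHat η κ) :=
  {v | ∃ (h : Fin η → ℝ) (h' : Fin κ → ℝ), (∀ j, 0 ≤ h j) ∧ Function.Injective h ∧
    (∀ j, 0 ≤ h' j) ∧ Function.Injective h' ∧ v ∈ linkedTo h h'}

end Variables

section System

variable {n m qA qB qAd qBd η κ : ℕ}

/-- The spectral controllability matrix
`(s I - A(zA) - ∑ j, wⱼ Aⱼ(zAd) : B(zB) + ∑ j, w'ⱼ Bⱼ(zBd))` of the nominal system, where `wⱼ`,
`w'ⱼ` stand for `exp (-hⱼ s)`, `exp (-h'ⱼ s)`. -/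
noncomputable def NominalSystem.ZC (S : NominalSystem n m qA qB qAd qBd η κ)
    (s : ℂ) (w : Fin η → ℂ) (w' : Fin κ → ℂ) (z : Param qA qB qAd qBd) :
    Matrix (Fin n) (Fin n ⊕ Fin m) ℂ :=
  Matrix.fromCols
    (s • (1 : Matrix (Fin n) (Fin n) ℂ)
      - ∑ i, (Fin.cons 1 z.1 : Fin (qA + 1) → ℂ) i • S.A i
      - ∑ j, w j • ∑ i, z.2.2.1 i • S.Ad j i)
    (∑ i, (Fin.cons 1 z.2.1 : Fin (qB + 1) → ℂ) i • S.B i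
      + ∑ j, w' j • ∑ i, z.2.2.2 i • S.Bd j i)

/-- The determinant of `ZC * ZCᴴ`. It is a real number, see `det_im`; the real part only
changes its type. -/
noncomputable def NominalSystem.detZ (S : NominalSystem n m qA qB qAd qBd η κ)
    (s : ℂ) (w : Fin η → ℂ) (w' : Fin κ → ℂ) (z : Param qA qB qAd qBd) : ℝ :=
  (S.ZC s w w' z * (S.ZC s w w' z)ᴴ).det.re

theorem NominalSystem.det_im (S : NominalSystem n m qA qB qAd qBd η κ)
    (s : ℂ) (w : Fin η → ℂ) (w' : Fin κ → ℂ) (z : Param qA qB qAd qBd) :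
    (S.ZC s w w' z * (S.ZC s w w' z)ᴴ).det.im = 0 := by
  rw [← Complex.conj_eq_iff_im]
  have h := (Matrix.isHermitian_mul_conjTranspose_self (S.ZC s w w' z)).eq
  have h2 := Matrix.det_conjTranspose (S.ZC s w w' z * (S.ZC s w w' z)ᴴ)
  rw [h] at h2
  exact h2.symm

/-- `detZ` at a value of the extended variables. -/
noncomputable def NominalSystem.detHat (S : NominalSystem n m qA qB qAd qBd η κ)
    (v : SigmaHat η κ) (z : Param qA qB qAd qBd) : ℝ :=
  S.detZ v.s (fun j => polar (v.ρ j) (v.φ j)) (fun j => polar (v.ρ' j) (v.φ' j)) z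

/-- (Spectral) controllability on the parameter set `C` for the delays `h`, `h'`: the spectral
controllability matrix has full rank at every complex `s`. -/
def NominalSystem.Controllable (S : NominalSystem n m qA qB qAd qBd η κ)
    (h : Fin η → ℝ) (h' : Fin κ → ℝ) (C : Set (Param qA qB qAd qBd)) : Prop :=
  ∀ s : ℂ, ∀ z ∈ C,
    (S.ZC s (fun j => Complex.exp (-(h j * s))) (fun j => Complex.exp (-(h' j * s))) z).rank = n

/-- Controllability on `C` independent of the delays. -/
def NominalSystem.ControllableIndep (S : NominalSystem n m qA qB qAd qBd η κ)
    (C : Set (Param qA qB qAd qBd)) : Prop :=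
  ∀ (h : Fin η → ℝ) (h' : Fin κ → ℝ), (∀ j, 0 ≤ h j) → Function.Injective h →
    (∀ j, 0 ≤ h' j) → Function.Injective h' → S.Controllable h h' C

/-- The determinant is at least `δ` for all extended variables in `Γ` and all parameters
in `C`. -/
def NominalSystem.LowerBound (S : NominalSystem n m qA qB qAd qBd η κ)
    (Γ : Set (SigmaHat η κ)) (C : Set (Param qA qB qAd qBd)) (δ : ℝ) : Prop :=
  ∀ v ∈ Γ, ∀ z ∈ C, δ ≤ S.detHat v z

end System

section Covers

/-- The open hyper-rectangle with lower corner `a` and upper corner `b`. -/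
def box {ι : Type} (a b : ι → ℝ) : Set (ι → ℝ) :=
  {x | ∀ j, x j ∈ Set.Ioo (a j) (b j)}

/-- The `j`-th partial derivative. -/
noncomputable def partialDeriv {ι : Type} [DecidableEq ι] (f : (ι → ℝ) → ℝ) (j : ι)
    (x : ι → ℝ) : ℝ :=
  deriv (fun t => f (Function.update x j t)) (x j)

/-- A finite cover of `T` by open hyper-rectangles, with one sample point `p i ∈ T` in each,
passes the test for `f` at level `δ`: on the `i`-th hyper-rectangle, whose edges have length at
most `ε i`, all partial derivatives are bounded by `M i`, and
`ε i ≤ δ' i / (d * M i)`, `f (p i) - d * M i * ε i ≥ δ' i ≥ δ`, where `d` is the number of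
coordinates. The function is evaluated at finitely many points only. -/
def FiniteCoverTest {ι : Type} [Fintype ι] [DecidableEq ι] (f : (ι → ℝ) → ℝ)
    (T : Set (ι → ℝ)) (δ : ℝ) : Prop :=
  ∃ (N : ℕ) (a b p : Fin N → ι → ℝ) (ε M δ' : Fin N → ℝ),
    T ⊆ ⋃ i, box (a i) (b i) ∧
    ∀ i, p i ∈ T ∧ p i ∈ box (a i) (b i) ∧
      0 < ε i ∧ (∀ j, b i j - a i j ≤ ε i) ∧
      0 ≤ M i ∧ (∀ x ∈ box (a i) (b i), ∀ j, |partialDeriv f j x| ≤ M i) ∧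
      δ ≤ δ' i ∧
      Fintype.card ι * M i * ε i ≤ δ' i ∧
      δ' i ≤ f (p i) - Fintype.card ι * M i * ε i

/-- Names of the real coordinates of `(s, z)`: the real and imaginary parts of `s` and of the
entries of the parameters. -/
inductive Coord (qA qB qAd qBd : ℕ) : Type
  | sigma : Coord qA qB qAd qBd
  | omega : Coord qA qB qAd qBd
  | reA (i : Fin qA) : Coord qA qB qAd qBd
  | imA (i : Fin qA) : Coord qA qB qAd qBd
  | reB (i : Fin qB) : Coord qA qB qAd qBd
  | imB (i : Fin qB) : Coord qA qB qAd qBd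
  | reAd (i : Fin qAd) : Coord qA qB qAd qBd
  | imAd (i : Fin qAd) : Coord qA qB qAd qBd
  | reBd (i : Fin qBd) : Coord qA qB qAd qBd
  | imBd (i : Fin qBd) : Coord qA qB qAd qBd
  deriving DecidableEq, Fintype

/-- Names of the additional real coordinates `ρ`, `φ`, `ρ'`, `φ'`. -/
inductive DelayCoord (η κ : ℕ) : Type
  | rho (j : Fin η) : DelayCoord η κ
  | phi (j : Fin η) : DelayCoord η κ
  | rho' (j : Fin κ) : DelayCoord η κ
  | phi' (j : Fin κ) : DelayCoord η κ
  deriving DecidableEq, Fintype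

variable {n m qA qB qAd qBd η κ : ℕ}

/-- The Laplace argument with the given real coordinates. -/
def argOf (x : Coord qA qB qAd qBd → ℝ) : ℂ :=
  ⟨x Coord.sigma, x Coord.omega⟩

/-- The parameter tuple with the given real coordinates. -/
def paramOf (x : Coord qA qB qAd qBd → ℝ) : Param qA qB qAd qBd :=
  (fun i => ⟨x (Coord.reA i), x (Coord.imA i)⟩, fun i => ⟨x (Coord.reB i), x (Coord.imB i)⟩,
    fun i => ⟨x (Coord.reAd i), x (Coord.imAd i)⟩, fun i => ⟨x (Coord.reBd i), x (Coord.imBd i)⟩)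

/-- The extended variables with the given real coordinates. -/
def extOf (x : Coord qA qB qAd qBd ⊕ DelayCoord η κ → ℝ) : SigmaHat η κ where
  σ := x (Sum.inl Coord.sigma)
  ω := x (Sum.inl Coord.omega)
  ρ := fun j => x (Sum.inr (DelayCoord.rho j))
  φ := fun j => x (Sum.inr (DelayCoord.phi j))
  ρ' := fun j => x (Sum.inr (DelayCoord.rho' j))
  φ' := fun j => x (Sum.inr (DelayCoord.phi' j))

/-- The determinant for the delays `h`, `h'` as a function of the real coordinates of `(s, z)`. -/
noncomputable def NominalSystem.detDelay (S : NominalSystem n m qA qB qAd qBd η κ)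
    (h : Fin η → ℝ) (h' : Fin κ → ℝ) (x : Coord qA qB qAd qBd → ℝ) : ℝ :=
  S.detZ (argOf x) (fun j => Complex.exp (-(h j * argOf x)))
    (fun j => Complex.exp (-(h' j * argOf x))) (paramOf x)

/-- The determinant as a function of all real coordinates of the extended variables and the
parameters. -/
noncomputable def NominalSystem.detExt (S : NominalSystem n m qA qB qAd qBd η κ)
    (x : Coord qA qB qAd qBd ⊕ DelayCoord η κ → ℝ) : ℝ :=
  S.detHat (extOf x) (paramOf fun c => x (Sum.inl c))

/-- The part of a set of extended variables where `s` and all moduli have size at most `R`. -/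
def truncate (Γ : Set (SigmaHat η κ)) (R : ℝ) : Set (SigmaHat η κ) :=
  {v | v ∈ Γ ∧ ‖v.s‖ ≤ R ∧ (∀ j, v.ρ j ≤ R) ∧ (∀ j, v.ρ' j ≤ R)}

/-- The product of the closed disc `‖s‖ ≤ R` and the parameter set `C`, in real coordinates. -/
def regionDelay (C : Set (Param qA qB qAd qBd)) (R : ℝ) : Set (Coord qA qB qAd qBd → ℝ) :=
  {x | ‖argOf x‖ ≤ R ∧ paramOf x ∈ C}

/-- The product of a truncated set of extended variables and the parameter set `C`, in real
coordinates. -/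
def regionExt (Γ : Set (SigmaHat η κ)) (C : Set (Param qA qB qAd qBd)) (R : ℝ) :
    Set (Coord qA qB qAd qBd ⊕ DelayCoord η κ → ℝ) :=
  {x | extOf x ∈ truncate Γ R ∧ paramOf (fun c => x (Sum.inl c)) ∈ C}

end Covers

end DelayControl

/-!
The matrix `Z` has full row rank exactly where `det (Z Zᴴ)` is positive, and the extended variables
linked to given delays run through all `s ∈ ℂ`, so a positive lower bound on the determinant gives
controllability. On a box with edges of length at most `ε` and partial derivatives bounded by `M`,
a function of `d` variables differs from its value at the sample point by at most `d M ε`, by the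
mean value inequality; conversely the partial derivatives of a `C¹` function are bounded near a
bounded set, so a cover by sufficiently small cubes passes the test. If controllability fails, then
it fails at a single point, which lies in every sufficiently large truncation. Finally,
`s I - ∑ zᵢ Aᵢ - ∑ wⱼ Aⱼ` is invertible once `|s|` exceeds the norm of what is subtracted from
`s I`, and this norm is bounded for bounded `w` and `z`.
-/

namespace DelayControl

section CoverTest

variable {ι : Type}

theorem box_eq_pi (a b : ι → ℝ) : box a b = Set.univ.pi fun j => Set.Ioo (a j) (b j) := by
  ext x
  simp [box]

theorem convex_box (a b : ι → ℝ) : Convex ℝ (box a b) := by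
  rw [box_eq_pi]
  exact convex_pi fun j _ => convex_Ioo _ _

theorem partialDeriv_eq_fderiv [Finite ι] [DecidableEq ι] {f : (ι → ℝ) → ℝ} {x : ι → ℝ}
    (hf : DifferentiableAt ℝ f x) (j : ι) :
    partialDeriv f j x = fderiv ℝ f x (Pi.single j 1) := by
  have := Fintype.ofFinite ι
  have hf' : HasFDerivAt f (fderiv ℝ f x) (Function.update x j (x j)) := by
    rw [Function.update_eq_self]
    exact hf.hasFDerivAt
  exact (hf'.comp_hasDerivAt (x j) (hasDerivAt_update x j (x j))).deriv

variable [Fintype ι]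

theorem box_sub_add_eq_ball (p : ι → ℝ) {r : ℝ} (hr : 0 < r) :
    box (fun j => p j - r) (fun j => p j + r) = Metric.ball p r := by
  simp only [box_eq_pi, ball_pi p hr, Real.ball_eq_Ioo]

theorem norm_sub_le_of_mem_box {a b x y : ι → ℝ} {ε : ℝ} (hε : 0 ≤ ε) (hab : ∀ j, b j - a j ≤ ε)
    (hx : x ∈ box a b) (hy : y ∈ box a b) : ‖x - y‖ ≤ ε := by
  refine (pi_norm_le_iff_of_nonneg hε).2 fun j => ?_
  rw [Pi.sub_apply, Real.norm_eq_abs, abs_le]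
  constructor <;> linarith [hab j, (hx j).1, (hx j).2, (hy j).1, (hy j).2]

variable [DecidableEq ι] {f : (ι → ℝ) → ℝ}

theorem fderiv_apply_eq_sum_partialDeriv {x : ι → ℝ} (hf : DifferentiableAt ℝ f x) (v : ι → ℝ) :
    fderiv ℝ f x v = ∑ j, v j * partialDeriv f j x := by
  conv_lhs => rw [pi_eq_sum_univ' v]
  simp only [map_sum, map_smul, smul_eq_mul, partialDeriv_eq_fderiv hf]

theorem abs_partialDeriv_le_norm_fderiv {x : ι → ℝ} (hf : DifferentiableAt ℝ f x) (j : ι) :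
    |partialDeriv f j x| ≤ ‖fderiv ℝ f x‖ := by
  have h := (fderiv ℝ f x).le_opNorm (Pi.single j 1)
  rwa [← partialDeriv_eq_fderiv hf, Pi.norm_single, norm_one, mul_one] at h

theorem norm_fderiv_le_of_abs_partialDeriv_le {x : ι → ℝ} (hf : DifferentiableAt ℝ f x) {M : ℝ}
    (hM : 0 ≤ M) (h : ∀ j, |partialDeriv f j x| ≤ M) : ‖fderiv ℝ f x‖ ≤ Fintype.card ι * M := by
  refine ContinuousLinearMap.opNorm_le_bound _ (by positivity) fun v => ?_
  rw [fderiv_apply_eq_sum_partialDeriv hf]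
  calc ‖∑ j, v j * partialDeriv f j x‖ ≤ ∑ _j : ι, ‖v‖ * M :=
        norm_sum_le_of_le _ fun j _ => (norm_mul _ _).trans_le <|
          mul_le_mul (norm_le_pi_norm v j) (h j) (norm_nonneg _) (norm_nonneg _)
    _ = Fintype.card ι * M * ‖v‖ := by
        rw [Finset.sum_const, Finset.card_univ, nsmul_eq_mul]
        ring

theorem abs_sub_le_of_mem_box {a b x p : ι → ℝ} {ε M : ℝ}
    (hf : ∀ y ∈ box a b, DifferentiableAt ℝ f y) (hε : 0 ≤ ε) (hab : ∀ j, b j - a j ≤ ε)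
    (hM : 0 ≤ M) (h : ∀ y ∈ box a b, ∀ j, |partialDeriv f j y| ≤ M) (hx : x ∈ box a b)
    (hp : p ∈ box a b) : |f x - f p| ≤ Fintype.card ι * M * ε :=
  calc |f x - f p| ≤ Fintype.card ι * M * ‖x - p‖ :=
        (convex_box a b).norm_image_sub_le_of_norm_fderiv_le hf
          (fun y hy => norm_fderiv_le_of_abs_partialDeriv_le (hf y hy) hM (h y hy)) hp hx
    _ ≤ Fintype.card ι * M * ε :=
        mul_le_mul_of_nonneg_left (norm_sub_le_of_mem_box hε hab hx hp) (by positivity)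

theorem FiniteCoverTest.le_apply {T : Set (ι → ℝ)} {δ : ℝ} (h : FiniteCoverTest f T δ)
    (hf : Differentiable ℝ f) {x : ι → ℝ} (hx : x ∈ T) : δ ≤ f x := by
  obtain ⟨N, a, b, p, ε, M, δ', hT, h⟩ := h
  obtain ⟨i, hi⟩ := Set.mem_iUnion.1 (hT hx)
  obtain ⟨-, hp, hε, hab, hM, hderiv, hδ, -, hsample⟩ := h i
  have hvar := abs_sub_le_of_mem_box (fun y _ => hf y) hε.le hab hM hderiv hi hp
  linarith [(abs_le.1 hvar).1]

theorem finiteCoverTest_of_abs_partialDeriv_le {T : Set (ι → ℝ)} {δ ε M : ℝ}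
    (hT : TotallyBounded T) (hε : 0 < ε) (hM : 0 ≤ M)
    (hderiv : ∀ x ∈ Metric.thickening ε T, ∀ j, |partialDeriv f j x| ≤ M)
    (hsmall : Fintype.card ι * M * (2 * ε) ≤ δ)
    (hsample : ∀ x ∈ T, δ ≤ f x - Fintype.card ι * M * (2 * ε)) : FiniteCoverTest f T δ := by
  obtain ⟨t, htT, htfin, hcover⟩ := Metric.finite_approx_of_totallyBounded hT ε hε
  have := htfin.fintype
  let e := Fintype.equivFin t
  let p : Fin (Fintype.card t) → ι → ℝ := fun i => e.symm i
  have hpT : ∀ i, p i ∈ T := fun i => htT (e.symm i).2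
  refine ⟨Fintype.card t, fun i j => p i j - ε, fun i j => p i j + ε, p, fun _ => 2 * ε,
    fun _ => M, fun _ => δ, fun x hx => ?_, fun i => ?_⟩
  · obtain ⟨y, hy, hxy⟩ := Set.mem_iUnion₂.1 (hcover hx)
    refine Set.mem_iUnion.2 ⟨e ⟨y, hy⟩, ?_⟩
    simpa only [box_sub_add_eq_ball _ hε, p, Equiv.symm_apply_apply] using hxy
  · rw [box_sub_add_eq_ball _ hε]
    exact ⟨hpT i, Metric.mem_ball_self hε, by positivity, fun j => by linarith, hM,
      fun x hx => hderiv x (Metric.ball_subset_thickening (hpT i) ε hx), le_rfl, hsmall,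
      hsample _ (hpT i)⟩

theorem exists_abs_partialDeriv_le (hf : ContDiff ℝ 1 f) {T : Set (ι → ℝ)}
    (hT : Bornology.IsBounded T) : ∃ M, 0 ≤ M ∧ ∀ x ∈ T, ∀ j, |partialDeriv f j x| ≤ M := by
  obtain ⟨M, hM⟩ := hT.isCompact_closure.exists_bound_of_continuousOn
    (hf.continuous_fderiv one_ne_zero).continuousOn
  refine ⟨max M 0, le_max_right _ _, fun x hx j => ?_⟩
  calc |partialDeriv f j x| ≤ ‖fderiv ℝ f x‖ :=
        abs_partialDeriv_le_norm_fderiv (hf.differentiable one_ne_zero x) j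
    _ ≤ max M 0 := (hM x (subset_closure hx)).trans (le_max_left _ _)

theorem finiteCoverTest_of_lt (hf : ContDiff ℝ 1 f) {T : Set (ι → ℝ)}
    (hT : Bornology.IsBounded T) {δ δ' : ℝ} (hδ' : 0 < δ') (hlt : δ' < δ)
    (h : ∀ x ∈ T, δ ≤ f x) : FiniteCoverTest f T δ' := by
  obtain ⟨M, hM, hderiv⟩ := exists_abs_partialDeriv_le hf (hT.thickening (δ := 1))
  obtain ⟨ε₀, hε₀, hsmall⟩ :=
    exists_pos_mul_lt (lt_min hδ' (sub_pos.2 hlt)) (Fintype.card ι * M * 2)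
  have hcard : Fintype.card ι * M * (2 * min ε₀ 1) ≤ min δ' (δ - δ') := by
    rw [← mul_assoc]
    exact (mul_le_mul_of_nonneg_left (min_le_left _ _) (by positivity)).trans hsmall.le
  refine finiteCoverTest_of_abs_partialDeriv_le
    (hT.isCompact_closure.totallyBounded.subset subset_closure) (lt_min hε₀ one_pos) hM
    (fun x hx => hderiv x (Metric.thickening_mono (min_le_right _ _) T hx))
    (hcard.trans (min_le_left _ _)) fun x hx => ?_
  linarith [h x hx, hcard.trans (min_le_right _ _)]

theorem exists_finiteCoverTest_iff (hf : ContDiff ℝ 1 f) {T : Set (ι → ℝ)}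
    (hT : Bornology.IsBounded T) :
    (∃ δ, 0 < δ ∧ FiniteCoverTest f T δ) ↔ ∃ δ, 0 < δ ∧ ∀ x ∈ T, δ ≤ f x :=
  ⟨fun ⟨δ, hδ, h⟩ => ⟨δ, hδ, fun _ hx => h.le_apply (hf.differentiable one_ne_zero) hx⟩,
    fun ⟨δ, hδ, h⟩ =>
      ⟨δ / 2, half_pos hδ, finiteCoverTest_of_lt hf hT (half_pos hδ) (half_lt_self hδ) h⟩⟩

end CoverTest

section ExtendedVariables

variable {η κ : ℕ}

theorem polar_eq_mul_exp (r θ : ℝ) : polar r θ = r * Complex.exp (θ * Complex.I) := by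
  rw [polar, Complex.exp_mul_I, Complex.ofReal_cos, Complex.ofReal_sin]

theorem polar_exp_add_two_pi_mul_int (h σ ω : ℝ) (k : ℤ) :
    polar (Real.exp (-(h * σ))) (-(h * ω) + 2 * Real.pi * k) =
      Complex.exp (-(h * (σ + ω * Complex.I))) := by
  rw [polar_eq_mul_exp, Complex.ofReal_exp, ← Complex.exp_add,
    Complex.exp_eq_exp_iff_exists_int]
  refine ⟨k, ?_⟩
  push_cast
  ring

theorem exists_mem_linkedTo (h : Fin η → ℝ) (h' : Fin κ → ℝ) (s : ℂ) :
    ∃ v ∈ linkedTo h h', v.s = s := by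
  have hangle (t : ℝ) : ∃ θ ∈ Set.Ico 0 (2 * Real.pi), ∃ k : ℤ, θ = t + 2 * Real.pi * k := by
    obtain ⟨k, hk, -⟩ := existsUnique_add_zsmul_mem_Ico Real.two_pi_pos t 0
    exact ⟨_, by simpa only [zero_add] using hk, k, by rw [zsmul_eq_mul, mul_comm]⟩
  choose θ hθ hθt using hangle
  exact ⟨⟨s.re, s.im, fun j => Real.exp (-(h j * s.re)), fun j => θ (-(h j * s.im)),
      fun j => Real.exp (-(h' j * s.re)), fun j => θ (-(h' j * s.im))⟩,
    ⟨⟨fun _ => Real.exp_pos _, fun _ => hθ _, fun _ => Real.exp_pos _, fun _ => hθ _⟩,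
      fun _ => rfl, fun _ => hθt _, fun _ => rfl, fun _ => hθt _⟩, Complex.re_add_im s⟩

theorem linkedToSome_subset_delayFree : linkedToSome η κ ⊆ delayFree η κ :=
  fun _ ⟨_, _, _, _, _, _, hv⟩ => hv.1

theorem linkedToSome_subset_and_subset_delayFree {Γ : Set (SigmaHat η κ)}
    (hΓ : Γ = delayFree η κ ∨ Γ = linkedToSome η κ) :
    linkedToSome η κ ⊆ Γ ∧ Γ ⊆ delayFree η κ := by
  rcases hΓ with rfl | rfl
  · exact ⟨linkedToSome_subset_delayFree, subset_rfl⟩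
  · exact ⟨subset_rfl, linkedToSome_subset_delayFree⟩

theorem eventually_mem_truncate {Γ : Set (SigmaHat η κ)} {v : SigmaHat η κ} (hv : v ∈ Γ) :
    ∀ᶠ R in Filter.atTop, v ∈ truncate Γ R := by
  filter_upwards [Filter.eventually_ge_atTop ‖v.s‖,
    Filter.eventually_all.2 fun j => Filter.eventually_ge_atTop (v.ρ j),
    Filter.eventually_all.2 fun j => Filter.eventually_ge_atTop (v.ρ' j)] with R hs hρ hρ'
  exact ⟨hv, hs, hρ, hρ'⟩

-- If `P` fails somewhere on `Γ`, take `R₀` so large that the truncations contain one such point.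
theorem exists_radius_forall_of_forall_truncate (Γ : Set (SigmaHat η κ))
    (P : SigmaHat η κ → Prop) :
    ∃ R₀ : ℝ, 0 < R₀ ∧ ∀ R, R₀ ≤ R → (∀ v ∈ truncate Γ R, P v) → ∀ v ∈ Γ, P v := by
  by_cases hP : ∀ v ∈ Γ, P v
  · exact ⟨1, one_pos, fun _ _ _ => hP⟩
  · push Not at hP
    obtain ⟨v, hv, hPv⟩ := hP
    obtain ⟨R₀, hR₀, hmem⟩ :=
      (Filter.atTop_basis_Ioi' (0 : ℝ)).eventually_iff.1 (eventually_mem_truncate hv)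
    exact ⟨R₀ + 1, by linarith, fun R hR hall =>
      absurd (hall v (hmem (Set.mem_Ioi.2 (by linarith)))) hPv⟩

end ExtendedVariables

section Rank

open scoped ComplexOrder

variable {k l : Type*} [Fintype k] [DecidableEq k] [Fintype l]

theorem rank_eq_card_iff_isUnit {K : Type*} [Field K] {M : Matrix k k K} :
    M.rank = Fintype.card k ↔ IsUnit M := by
  refine ⟨fun h => ?_, Matrix.rank_of_isUnit M⟩
  have hrange : LinearMap.range M.mulVecLin = ⊤ :=
    Submodule.eq_top_of_finrank_eq (h.trans (Module.finrank_fintype_fun_eq_card K).symm)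
  exact Matrix.mulVec_surjective_iff_isUnit.1 (LinearMap.range_eq_top.1 hrange)

theorem det_mul_conjTranspose_self_pos_iff {𝕜 : Type*} [RCLike 𝕜] {M : Matrix k l 𝕜} :
    0 < (M * Mᴴ).det ↔ M.rank = Fintype.card k := by
  have hM := Matrix.posSemidef_self_mul_conjTranspose M
  rw [← Matrix.rank_self_mul_conjTranspose, rank_eq_card_iff_isUnit, ← hM.posDef_iff_isUnit]
  exact ⟨fun h => hM.posDef_iff_det_ne_zero.2 h.ne', fun h => h.det_pos⟩

theorem rank_fromCols_of_isUnit {R : Type*} [CommRing R] [StrongRankCondition R]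
    {A : Matrix k k R} (hA : IsUnit A) (B : Matrix k l R) :
    (Matrix.fromCols A B).rank = Fintype.card k := by
  classical
  refine le_antisymm (Matrix.rank_le_card_height _) ?_
  have h := Matrix.rank_mul_le_left (Matrix.fromCols A B)
    (Matrix.fromRows (1 : Matrix k k R) (0 : Matrix l k R))
  rwa [Matrix.fromCols_mul_fromRows, Matrix.mul_one, Matrix.mul_zero, add_zero,
    Matrix.rank_of_isUnit A hA] at h

end Rank

namespace NominalSystem

variable {n m qA qB qAd qBd η κ : ℕ} (S : NominalSystem n m qA qB qAd qBd η κ)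

section Controllability

open scoped ComplexOrder in
theorem detZ_pos_iff {s : ℂ} {w : Fin η → ℂ} {w' : Fin κ → ℂ} {z : Param qA qB qAd qBd} :
    0 < S.detZ s w w' z ↔ (S.ZC s w w' z).rank = n := by
  have h := det_mul_conjTranspose_self_pos_iff (M := S.ZC s w w' z)
  rwa [Complex.pos_iff, S.det_im, and_iff_left rfl, Fintype.card_fin] at h

theorem detHat_of_mem_linkedTo {h : Fin η → ℝ} {h' : Fin κ → ℝ} {v : SigmaHat η κ}
    (hv : v ∈ linkedTo h h') (z : Param qA qB qAd qBd) :
    S.detHat v z = S.detZ v.s (fun j => Complex.exp (-(h j * v.s)))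
      (fun j => Complex.exp (-(h' j * v.s))) z := by
  have hpolar {d r θ : ℝ} (hr : r = Real.exp (-(d * v.σ)))
      (hθ : ∃ k : ℤ, θ = -(d * v.ω) + 2 * Real.pi * k) :
      polar r θ = Complex.exp (-(d * v.s)) := by
    obtain ⟨k, rfl⟩ := hθ
    rw [hr, polar_exp_add_two_pi_mul_int, SigmaHat.s]
  obtain ⟨-, hρ, hφ, hρ', hφ'⟩ := hv
  simp only [detHat, fun j => hpolar (hρ j) (hφ j), fun j => hpolar (hρ' j) (hφ' j)]

variable {S} {C : Set (Param qA qB qAd qBd)} {δ : ℝ}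

theorem controllable_iff {h : Fin η → ℝ} {h' : Fin κ → ℝ} :
    S.Controllable h h' C ↔ ∀ v ∈ linkedTo h h', ∀ z ∈ C, 0 < S.detHat v z := by
  constructor
  · intro H v hv z hz
    rw [S.detHat_of_mem_linkedTo hv, S.detZ_pos_iff]
    exact H v.s z hz
  · intro H s z hz
    obtain ⟨v, hv, rfl⟩ := exists_mem_linkedTo h h' s
    rw [← S.detZ_pos_iff, ← S.detHat_of_mem_linkedTo hv]
    exact H v hv z hz

theorem controllableIndep_iff :
    S.ControllableIndep C ↔ ∀ v ∈ linkedToSome η κ, ∀ z ∈ C, 0 < S.detHat v z :=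
  ⟨fun H v ⟨h, h', h0, hinj, h0', hinj', hv⟩ =>
      controllable_iff.1 (H h h' h0 hinj h0' hinj') v hv,
    fun H h h' h0 hinj h0' hinj' =>
      controllable_iff.2 fun v hv => H v ⟨h, h', h0, hinj, h0', hinj', hv⟩⟩

theorem LowerBound.detHat_pos {Γ : Set (SigmaHat η κ)} (H : S.LowerBound Γ C δ) (hδ : 0 < δ) :
    ∀ v ∈ Γ, ∀ z ∈ C, 0 < S.detHat v z :=
  fun v hv z hz => hδ.trans_le (H v hv z hz)

theorem LowerBound.mono {Γ Γ' : Set (SigmaHat η κ)} (H : S.LowerBound Γ' C δ) (hΓ : Γ ⊆ Γ') :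
    S.LowerBound Γ C δ :=
  fun v hv => H v (hΓ hv)

theorem exists_radius_controllableIndep {Γ : Set (SigmaHat η κ)} (hΓ : linkedToSome η κ ⊆ Γ) :
    ∃ R₀ : ℝ, 0 < R₀ ∧ ∀ R, R₀ ≤ R → ∀ δ, 0 < δ → S.LowerBound (truncate Γ R) C δ →
      S.ControllableIndep C := by
  obtain ⟨R₀, hR₀, H⟩ :=
    exists_radius_forall_of_forall_truncate Γ fun v => ∀ z ∈ C, 0 < S.detHat v z
  exact ⟨R₀, hR₀, fun R hR δ hδ hlow => controllableIndep_iff.2 fun v hv =>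
    H R hR (hlow.detHat_pos hδ) v (hΓ hv)⟩

theorem exists_radius_controllable (h : Fin η → ℝ) (h' : Fin κ → ℝ) :
    ∃ R₀ : ℝ, 0 < R₀ ∧ ∀ R, R₀ ≤ R → ∀ δ, 0 < δ →
      S.LowerBound {v | v ∈ linkedTo h h' ∧ ‖v.s‖ ≤ R} C δ → S.Controllable h h' C := by
  obtain ⟨R₀, hR₀, H⟩ := exists_radius_forall_of_forall_truncate (linkedTo h h') fun v =>
    ∀ z ∈ C, 0 < S.detHat v z
  exact ⟨R₀, hR₀, fun R hR δ hδ hlow => controllable_iff.2 <|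
    H R hR fun v hv => hlow.detHat_pos hδ v ⟨hv.1, hv.2.1⟩⟩

end Controllability

section Blocks

/-- The matrix `A(zA) + ∑ j, wⱼ Aⱼ(zAd)`, so that the left block of `ZC` is
`s I - S.stateMatrix w z`. -/
noncomputable def stateMatrix (w : Fin η → ℂ) (z : Param qA qB qAd qBd) :
    Matrix (Fin n) (Fin n) ℂ :=
  ∑ i, (Fin.cons 1 z.1 : Fin (qA + 1) → ℂ) i • S.A i + ∑ j, w j • ∑ i, z.2.2.1 i • S.Ad j i

/-- The matrix `B(zB) + ∑ j, w'ⱼ Bⱼ(zBd)`, which is the right block of `ZC`. -/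
noncomputable def inputMatrix (w' : Fin κ → ℂ) (z : Param qA qB qAd qBd) :
    Matrix (Fin n) (Fin m) ℂ :=
  ∑ i, (Fin.cons 1 z.2.1 : Fin (qB + 1) → ℂ) i • S.B i + ∑ j, w' j • ∑ i, z.2.2.2 i • S.Bd j i

theorem ZC_eq_fromCols (s : ℂ) (w : Fin η → ℂ) (w' : Fin κ → ℂ) (z : Param qA qB qAd qBd) :
    S.ZC s w w' z = Matrix.fromCols (s • 1 - S.stateMatrix w z) (S.inputMatrix w' z) := by
  rw [ZC, stateMatrix, inputMatrix, sub_sub]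

theorem contDiff_stateMatrix_apply {r : WithTop ℕ∞} (i j : Fin n) :
    ContDiff ℝ r fun p : (Fin η → ℂ) × Param qA qB qAd qBd => S.stateMatrix p.1 p.2 i j := by
  simp only [stateMatrix, Fin.sum_univ_succ, Fin.cons_zero, Fin.cons_succ, Matrix.add_apply,
    Matrix.smul_apply, Matrix.sum_apply, smul_eq_mul]
  fun_prop

theorem contDiff_inputMatrix_apply {r : WithTop ℕ∞} (i : Fin n) (j : Fin m) :
    ContDiff ℝ r fun p : (Fin κ → ℂ) × Param qA qB qAd qBd => S.inputMatrix p.1 p.2 i j := by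
  simp only [inputMatrix, Fin.sum_univ_succ, Fin.cons_zero, Fin.cons_succ, Matrix.add_apply,
    Matrix.smul_apply, Matrix.sum_apply, smul_eq_mul]
  fun_prop

theorem rank_ZC_of_mem_resolventSet {s : ℂ} {w : Fin η → ℂ} {z : Param qA qB qAd qBd}
    (hs : s ∈ resolventSet ℂ (S.stateMatrix w z)) (w' : Fin κ → ℂ) :
    (S.ZC s w w' z).rank = n := by
  rw [spectrum.mem_resolventSet_iff, Algebra.algebraMap_eq_smul_one] at hs
  rw [ZC_eq_fromCols, rank_fromCols_of_isUnit hs, Fintype.card_fin]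

open scoped Matrix.Norms.Operator in
theorem exists_norm_stateMatrix_le {T : Set ((Fin η → ℂ) × Param qA qB qAd qBd)}
    (hT : Bornology.IsBounded T) : ∃ K, ∀ p ∈ T, ‖S.stateMatrix p.1 p.2‖ ≤ K := by
  have hcont : Continuous fun p : (Fin η → ℂ) × Param qA qB qAd qBd => S.stateMatrix p.1 p.2 :=
    continuous_matrix fun i j => (S.contDiff_stateMatrix_apply (r := 0) i j).continuous
  obtain ⟨K, hK⟩ := hT.isCompact_closure.exists_bound_of_continuousOn hcont.continuousOn
  exact ⟨K, fun p hp => hK p (subset_closure hp)⟩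

open scoped Matrix.Norms.Operator in
theorem exists_radius_rank_ZC_eq {C : Set (Param qA qB qAd qBd)} (hC : Bornology.IsBounded C)
    (r : ℝ) :
    ∃ R₀ : ℝ, ∀ (s : ℂ) (w : Fin η → ℂ) (w' : Fin κ → ℂ), (∀ j, ‖w j‖ ≤ r) →
      R₀ < ‖s‖ → ∀ z ∈ C, (S.ZC s w w' z).rank = n := by
  obtain ⟨K, hK⟩ := S.exists_norm_stateMatrix_le
    ((Bornology.IsBounded.pi fun _ => Metric.isBounded_closedBall (x := 0) (r := r)).prod hC)
  refine ⟨K * ‖(1 : Matrix (Fin n) (Fin n) ℂ)‖, fun s w w' hw hs z hz => ?_⟩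
  have hwz : ‖S.stateMatrix w z‖ ≤ K :=
    hK (w, z) ⟨fun j _ => mem_closedBall_zero_iff.2 (hw j), hz⟩
  exact S.rank_ZC_of_mem_resolventSet (spectrum.mem_resolventSet_of_norm_lt_mul
    ((mul_le_mul_of_nonneg_right hwz (norm_nonneg _)).trans_lt hs)) w'

end Blocks

end NominalSystem

section Smoothness

variable {E : Type*} [NormedAddCommGroup E] [NormedSpace ℝ E] {r : WithTop ℕ∞}

@[fun_prop]
theorem contDiff_ofReal {f : E → ℝ} (hf : ContDiff ℝ r f) : ContDiff ℝ r fun x => (f x : ℂ) :=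
  Complex.ofRealCLM.contDiff.comp hf

@[fun_prop]
theorem contDiff_complex_mk {f g : E → ℝ} (hf : ContDiff ℝ r f) (hg : ContDiff ℝ r g) :
    ContDiff ℝ r fun x => (⟨f x, g x⟩ : ℂ) :=
  Complex.equivRealProdCLM.symm.contDiff.comp (hf.prodMk hg)

@[fun_prop]
theorem contDiff_polar {f g : E → ℝ} (hf : ContDiff ℝ r f) (hg : ContDiff ℝ r g) :
    ContDiff ℝ r fun x => polar (f x) (g x) := by
  unfold polar
  fun_prop

theorem contDiff_det {k 𝔸 : Type*} [Fintype k] [DecidableEq k] [NormedCommRing 𝔸]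
    [NormedAlgebra ℝ 𝔸] {M : E → Matrix k k 𝔸} (hM : ∀ i j, ContDiff ℝ r fun x => M x i j) :
    ContDiff ℝ r fun x => (M x).det := by
  simp only [Matrix.det_apply']
  exact ContDiff.sum fun σ _ => contDiff_const.mul (contDiff_prod fun i _ => hM _ _)

variable {n m qA qB qAd qBd η κ : ℕ}

@[fun_prop]
theorem contDiff_argOf : ContDiff ℝ r (argOf : (Coord qA qB qAd qBd → ℝ) → ℂ) := by
  unfold argOf
  fun_prop

@[fun_prop]
theorem contDiff_paramOf :
    ContDiff ℝ r (paramOf : (Coord qA qB qAd qBd → ℝ) → Param qA qB qAd qBd) := by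
  unfold paramOf
  fun_prop

namespace NominalSystem

variable (S : NominalSystem n m qA qB qAd qBd η κ)

theorem contDiff_ZC_apply (i : Fin n) (c : Fin n ⊕ Fin m) :
    ContDiff ℝ r fun p : ℂ × (Fin η → ℂ) × (Fin κ → ℂ) × Param qA qB qAd qBd =>
      S.ZC p.1 p.2.1 p.2.2.1 p.2.2.2 i c := by
  have hstate (j) := (S.contDiff_stateMatrix_apply (r := r) i j).comp
    (contDiff_snd.fst.prodMk contDiff_snd.snd.snd :
      ContDiff ℝ r fun p : ℂ × (Fin η → ℂ) × (Fin κ → ℂ) × Param qA qB qAd qBd => (p.2.1, p.2.2.2))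
  have hinput (j) := (S.contDiff_inputMatrix_apply (r := r) i j).comp
    (contDiff_snd.snd :
      ContDiff ℝ r fun p : ℂ × (Fin η → ℂ) × (Fin κ → ℂ) × Param qA qB qAd qBd => p.2.2)
  simp only [ZC_eq_fromCols]
  rcases c with j | j
  · exact (contDiff_fst.mul contDiff_const).sub (hstate j)
  · exact hinput j

theorem contDiff_detZ :
    ContDiff ℝ r fun p : ℂ × (Fin η → ℂ) × (Fin κ → ℂ) × Param qA qB qAd qBd =>
      S.detZ p.1 p.2.1 p.2.2.1 p.2.2.2 := by
  refine Complex.reCLM.contDiff.comp (contDiff_det fun i j => ?_)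
  simp only [Matrix.mul_apply, Matrix.conjTranspose_apply]
  exact ContDiff.sum fun c _ =>
    (S.contDiff_ZC_apply i c).mul (Complex.conjCLE.contDiff.comp (S.contDiff_ZC_apply j c))

theorem contDiff_detDelay (h : Fin η → ℝ) (h' : Fin κ → ℝ) :
    ContDiff ℝ r (S.detDelay h h') := by
  refine S.contDiff_detZ.comp (f := fun x => (argOf x, fun j => Complex.exp (-(h j * argOf x)),
    fun j => Complex.exp (-(h' j * argOf x)), paramOf x)) ?_
  fun_prop

theorem contDiff_detExt : ContDiff ℝ r S.detExt := by
  refine S.contDiff_detZ.comp (f := fun x => ((extOf x).s,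
    fun j => polar ((extOf x).ρ j) ((extOf x).φ j),
    fun j => polar ((extOf x).ρ' j) ((extOf x).φ' j), paramOf fun c => x (Sum.inl c))) ?_
  simp only [SigmaHat.s, extOf]
  fun_prop

end NominalSystem

end Smoothness

section Regions

variable {n m qA qB qAd qBd η κ : ℕ} {C : Set (Param qA qB qAd qBd)}

/-- The real coordinates of a Laplace argument and a parameter tuple; inverse to `argOf`
and `paramOf`. -/
def coordsOf (s : ℂ) (z : Param qA qB qAd qBd) : Coord qA qB qAd qBd → ℝ
  | Coord.sigma => s.re
  | Coord.omega => s.im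
  | Coord.reA i => (z.1 i).re
  | Coord.imA i => (z.1 i).im
  | Coord.reB i => (z.2.1 i).re
  | Coord.imB i => (z.2.1 i).im
  | Coord.reAd i => (z.2.2.1 i).re
  | Coord.imAd i => (z.2.2.1 i).im
  | Coord.reBd i => (z.2.2.2 i).re
  | Coord.imBd i => (z.2.2.2 i).im

/-- The real coordinates of a value of the extended variables and a parameter tuple; inverse to
`extOf` and `paramOf`. -/
def extCoordsOf (v : SigmaHat η κ) (z : Param qA qB qAd qBd) :
    Coord qA qB qAd qBd ⊕ DelayCoord η κ → ℝ
  | Sum.inl c => coordsOf ⟨v.σ, v.ω⟩ z c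
  | Sum.inr (DelayCoord.rho j) => v.ρ j
  | Sum.inr (DelayCoord.phi j) => v.φ j
  | Sum.inr (DelayCoord.rho' j) => v.ρ' j
  | Sum.inr (DelayCoord.phi' j) => v.φ' j

theorem coordsOf_argOf_paramOf (x : Coord qA qB qAd qBd → ℝ) :
    coordsOf (argOf x) (paramOf x) = x := by
  funext c
  cases c <;> rfl

theorem continuous_coordsOf :
    Continuous fun p : ℂ × Param qA qB qAd qBd => coordsOf p.1 p.2 := by
  refine continuous_pi fun c => ?_
  cases c <;> simp only [coordsOf] <;> fun_prop

theorem s_extOf (x : Coord qA qB qAd qBd ⊕ DelayCoord η κ → ℝ) :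
    (extOf x).s = argOf fun c => x (Sum.inl c) :=
  (Complex.mk_eq_add_mul_I _ _).symm

theorem isBounded_regionDelay (hC : Bornology.IsBounded C) (R : ℝ) :
    Bornology.IsBounded (regionDelay C R) := by
  have hbdd : Bornology.IsBounded (Metric.closedBall (0 : ℂ) R ×ˢ C) :=
    Metric.isBounded_closedBall.prod hC
  refine (hbdd.isCompact_closure.image continuous_coordsOf).isBounded.subset ?_
  rintro x ⟨hs, hz⟩
  exact ⟨(argOf x, paramOf x), subset_closure ⟨mem_closedBall_zero_iff.2 hs, hz⟩,
    coordsOf_argOf_paramOf x⟩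

theorem isBounded_regionExt {Γ : Set (SigmaHat η κ)} (hΓ : Γ ⊆ delayFree η κ)
    (hC : Bornology.IsBounded C) (R : ℝ) : Bornology.IsBounded (regionExt Γ C R) := by
  refine Bornology.forall_isBounded_image_eval_iff.1 ?_
  rintro (c | j | j | j | j)
  · refine ((isBounded_regionDelay hC R).image_eval c).subset ?_
    rintro _ ⟨x, ⟨hx, hz⟩, rfl⟩
    exact ⟨fun c => x (Sum.inl c), ⟨s_extOf x ▸ hx.2.1, hz⟩, rfl⟩
  · refine (Metric.isBounded_Icc 0 R).subset ?_
    rintro _ ⟨x, ⟨⟨hx, -, hρ, -⟩, -⟩, rfl⟩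
    exact ⟨((hΓ hx).1 j).le, hρ j⟩
  · refine (Metric.isBounded_Ico 0 (2 * Real.pi)).subset ?_
    rintro _ ⟨x, ⟨⟨hx, -⟩, -⟩, rfl⟩
    exact (hΓ hx).2.1 j
  · refine (Metric.isBounded_Icc 0 R).subset ?_
    rintro _ ⟨x, ⟨⟨hx, -, -, hρ'⟩, -⟩, rfl⟩
    exact ⟨((hΓ hx).2.2.1 j).le, hρ' j⟩
  · refine (Metric.isBounded_Ico 0 (2 * Real.pi)).subset ?_
    rintro _ ⟨x, ⟨⟨hx, -⟩, -⟩, rfl⟩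
    exact (hΓ hx).2.2.2 j

end Regions

namespace NominalSystem

variable {n m qA qB qAd qBd η κ : ℕ} (S : NominalSystem n m qA qB qAd qBd η κ)
  {C : Set (Param qA qB qAd qBd)}

theorem lowerBound_truncate_iff (Γ : Set (SigmaHat η κ)) (R δ : ℝ) :
    S.LowerBound (truncate Γ R) C δ ↔ ∀ x ∈ regionExt Γ C R, δ ≤ S.detExt x :=
  ⟨fun H _ hx => H _ hx.1 _ hx.2, fun H v hv z hz => H (extCoordsOf v z) ⟨hv, hz⟩⟩

theorem lowerBound_linkedTo_iff (h : Fin η → ℝ) (h' : Fin κ → ℝ) (R δ : ℝ) :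
    S.LowerBound {v | v ∈ linkedTo h h' ∧ ‖v.s‖ ≤ R} C δ ↔
      ∀ x ∈ regionDelay C R, δ ≤ S.detDelay h h' x := by
  constructor
  · rintro H x ⟨hs, hz⟩
    obtain ⟨v, hv, hvs⟩ := exists_mem_linkedTo h h' (argOf x)
    have hle := H v ⟨hv, hvs ▸ hs⟩ _ hz
    rwa [S.detHat_of_mem_linkedTo hv, hvs] at hle
  · rintro H v ⟨hv, hs⟩ z hz
    rw [S.detHat_of_mem_linkedTo hv]
    exact H (coordsOf v.s z) ⟨hs, hz⟩

theorem exists_finiteCoverTest_detExt_iff (hC : Bornology.IsBounded C) {Γ : Set (SigmaHat η κ)}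
    (hΓ : Γ ⊆ delayFree η κ) (R : ℝ) :
    (∃ δ : ℝ, 0 < δ ∧ FiniteCoverTest S.detExt (regionExt Γ C R) δ) ↔
      ∃ δ : ℝ, 0 < δ ∧ S.LowerBound (truncate Γ R) C δ := by
  simp only [lowerBound_truncate_iff]
  exact exists_finiteCoverTest_iff S.contDiff_detExt (isBounded_regionExt hΓ hC R)

theorem exists_finiteCoverTest_detDelay_iff (hC : Bornology.IsBounded C) (h : Fin η → ℝ)
    (h' : Fin κ → ℝ) (R : ℝ) :
    (∃ δ : ℝ, 0 < δ ∧ FiniteCoverTest (S.detDelay h h') (regionDelay C R) δ) ↔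
      ∃ δ : ℝ, 0 < δ ∧ S.LowerBound {v | v ∈ linkedTo h h' ∧ ‖v.s‖ ≤ R} C δ := by
  simp only [lowerBound_linkedTo_iff]
  exact exists_finiteCoverTest_iff (S.contDiff_detDelay h h') (isBounded_regionDelay hC R)

theorem exists_radius_controllableIndep_of_finiteCoverTest (C : Set (Param qA qB qAd qBd))
    {Γ : Set (SigmaHat η κ)} (hΓ : linkedToSome η κ ⊆ Γ) :
    ∃ R₀ : ℝ, 0 < R₀ ∧ ∀ R : ℝ, R₀ ≤ R → ∀ δ : ℝ, 0 < δ →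
      FiniteCoverTest S.detExt (regionExt Γ C R) δ → S.ControllableIndep C := by
  obtain ⟨R₀, hR₀, H⟩ := exists_radius_controllableIndep (S := S) (C := C) hΓ
  exact ⟨R₀, hR₀, fun R hR δ hδ htest => H R hR δ hδ <| (S.lowerBound_truncate_iff Γ R δ).2
    fun _ => htest.le_apply (S.contDiff_detExt.differentiable one_ne_zero)⟩

theorem exists_radius_controllable_of_finiteCoverTest (C : Set (Param qA qB qAd qBd))
    (h : Fin η → ℝ) (h' : Fin κ → ℝ) :
    ∃ R₀ : ℝ, 0 < R₀ ∧ ∀ R : ℝ, R₀ ≤ R → ∀ δ : ℝ, 0 < δ →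
      FiniteCoverTest (S.detDelay h h') (regionDelay C R) δ → S.Controllable h h' C := by
  obtain ⟨R₀, hR₀, H⟩ := exists_radius_controllable (S := S) (C := C) h h'
  exact ⟨R₀, hR₀, fun R hR δ hδ htest => H R hR δ hδ <| (S.lowerBound_linkedTo_iff h h' R δ).2
    fun _ => htest.le_apply ((S.contDiff_detDelay h h').differentiable one_ne_zero)⟩

end NominalSystem

end DelayControl

open DelayControl in
theorem theorem5p2_general {n m qA qB qAd qBd η κ : ℕ}
    (S : NominalSystem n m qA qB qAd qBd η κ) {C : Set (Param qA qB qAd qBd)}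
    (hC : Bornology.IsBounded C) :
    (∀ Γ : Set (SigmaHat η κ), linkedToSome η κ ⊆ Γ →
      ∀ δ : ℝ, 0 < δ → S.LowerBound Γ C δ → S.ControllableIndep C) ∧
    (∀ (h : Fin η → ℝ) (h' : Fin κ → ℝ),
      ∀ δ : ℝ, 0 < δ → S.LowerBound (linkedTo h h') C δ → S.Controllable h h' C) ∧
    (∀ Γ : Set (SigmaHat η κ),
      (Γ ⊆ delayFree η κ → ∀ R : ℝ,
        (∃ δ : ℝ, 0 < δ ∧ FiniteCoverTest S.detExt (regionExt Γ C R) δ) ↔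
          ∃ δ : ℝ, 0 < δ ∧ S.LowerBound (truncate Γ R) C δ) ∧
      (linkedToSome η κ ⊆ Γ → ∃ R₀ : ℝ, 0 < R₀ ∧ ∀ R : ℝ, R₀ ≤ R → ∀ δ : ℝ, 0 < δ →
        FiniteCoverTest S.detExt (regionExt Γ C R) δ → S.ControllableIndep C)) ∧
    (∀ (h : Fin η → ℝ) (h' : Fin κ → ℝ),
      (∀ R : ℝ, (∃ δ : ℝ, 0 < δ ∧ FiniteCoverTest (S.detDelay h h') (regionDelay C R) δ) ↔
          ∃ δ : ℝ, 0 < δ ∧ S.LowerBound {v | v ∈ linkedTo h h' ∧ ‖v.s‖ ≤ R} C δ) ∧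
      ∃ R₀ : ℝ, 0 < R₀ ∧ ∀ R : ℝ, R₀ ≤ R → ∀ δ : ℝ, 0 < δ →
        FiniteCoverTest (S.detDelay h h') (regionDelay C R) δ → S.Controllable h h' C) ∧
    (∀ r : ℝ, ∃ R₀ : ℝ, ∀ (s : ℂ) (w : Fin η → ℂ) (w' : Fin κ → ℂ), (∀ j, ‖w j‖ ≤ r) →
      R₀ < ‖s‖ → ∀ z ∈ C, (S.ZC s w w' z).rank = n) :=
  ⟨fun _ hΓ _ hδ H => NominalSystem.controllableIndep_iff.2 ((H.mono hΓ).detHat_pos hδ),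
    fun _ _ _ hδ H => NominalSystem.controllable_iff.2 (H.detHat_pos hδ),
    fun _ => ⟨S.exists_finiteCoverTest_detExt_iff hC,
      S.exists_radius_controllableIndep_of_finiteCoverTest C⟩,
    fun h h' => ⟨S.exists_finiteCoverTest_detDelay_iff hC h h',
      S.exists_radius_controllable_of_finiteCoverTest C h h'⟩,
    S.exists_radius_rank_ZC_eq hC⟩

theorem theorem5p2 {n m qA qB qAd qBd η κ : ℕ}
    (S : DelayControl.NominalSystem n m qA qB qAd qBd η κ)
    (CA : Set (Fin qA → ℂ)) (CB : Set (Fin qB → ℂ))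
    (CAd : Set (Fin qAd → ℂ)) (CBd : Set (Fin qBd → ℂ))
    (C : Set (DelayControl.Param qA qB qAd qBd)) (hC : C = CA ×ˢ CB ×ˢ CAd ×ˢ CBd)
    (hbdd : Bornology.IsBounded C) :
    -- (i) independence of the delays; the determinant may be tested on all delay-free extended
    -- variables, or only on those that are linked to `s` by some set of delays
    (∀ Γ : Set (DelayControl.SigmaHat η κ),
      (Γ = DelayControl.delayFree η κ ∨ Γ = DelayControl.linkedToSome η κ) →
      ∀ δ : ℝ, 0 < δ → S.LowerBound Γ C δ → S.ControllableIndep C) ∧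
    -- (ii) given delays
    (∀ (h : Fin η → ℝ) (h' : Fin κ → ℝ), (∀ j, 0 < h j) → Function.Injective h →
      (∀ j, 0 < h' j) → Function.Injective h' →
      ∀ δ : ℝ, 0 < δ → S.LowerBound (DelayControl.linkedTo h h') C δ → S.Controllable h h' C) ∧
    -- (iii) finite covers for (i)
    (∀ Γ : Set (DelayControl.SigmaHat η κ),
      (Γ = DelayControl.delayFree η κ ∨ Γ = DelayControl.linkedToSome η κ) →
      (∀ R : ℝ, 0 < R →
        ((∃ δ : ℝ, 0 < δ ∧
            DelayControl.FiniteCoverTest S.detExt (DelayControl.regionExt Γ C R) δ) ↔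
          ∃ δ : ℝ, 0 < δ ∧ S.LowerBound (DelayControl.truncate Γ R) C δ)) ∧
      ∃ R₀ : ℝ, 0 < R₀ ∧ ∀ R : ℝ, R₀ ≤ R → ∀ δ : ℝ, 0 < δ →
        DelayControl.FiniteCoverTest S.detExt (DelayControl.regionExt Γ C R) δ →
        S.ControllableIndep C) ∧
    -- (iii) finite covers for (ii)
    (∀ (h : Fin η → ℝ) (h' : Fin κ → ℝ), (∀ j, 0 < h j) → Function.Injective h →
      (∀ j, 0 < h' j) → Function.Injective h' →
      (∀ R : ℝ, 0 < R →
        ((∃ δ : ℝ, 0 < δ ∧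
            DelayControl.FiniteCoverTest (S.detDelay h h') (DelayControl.regionDelay C R) δ) ↔
          ∃ δ : ℝ, 0 < δ ∧
            S.LowerBound {v | v ∈ DelayControl.linkedTo h h' ∧ ‖v.s‖ ≤ R} C δ)) ∧
      ∃ R₀ : ℝ, 0 < R₀ ∧ ∀ R : ℝ, R₀ ≤ R → ∀ δ : ℝ, 0 < δ →
        DelayControl.FiniteCoverTest (S.detDelay h h') (DelayControl.regionDelay C R) δ →
        S.Controllable h h' C) ∧
    -- (iii) outside a disc there is nothing to test as long as the moduli for the internal
    -- delays stay bounded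
    (∀ r : ℝ, ∃ R₀ : ℝ, ∀ (s : ℂ) (w : Fin η → ℂ) (w' : Fin κ → ℂ), (∀ j, ‖w j‖ ≤ r) →
      R₀ < ‖s‖ → ∀ z ∈ C, (S.ZC s w w' z).rank = n) :=
  have ⟨indep, fixed, coverIndep, coverFixed, large⟩ := theorem5p2_general S hbdd
  have sandwich {Γ} := DelayControl.linkedToSome_subset_and_subset_delayFree (Γ := Γ)
  ⟨fun Γ hΓ => indep Γ (sandwich hΓ).1, fun h h' _ _ _ _ => fixed h h',
    fun Γ hΓ => ⟨fun R _ => (coverIndep Γ).1 (sandwich hΓ).2 R, (coverIndep Γ).2 (sandwich hΓ).1⟩,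
    fun h h' _ _ _ _ => ⟨fun R _ => (coverFixed h h').1 R, (coverFixed h h').2⟩, large⟩
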